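/- Let $i\in\mathbb{N}_0$, let $\alpha,\beta,\epsilon\in\mathbb{C}$, and put $\mathbb{Z}_0^-=\{0,-1,-2,\dots\}$. For $\lambda\in\mathbb{C}$ let $(\lambda)_0=1$ and $(\lambda)_n=\lambda(\lambda+1)\cdots(\lambda+n-1)$ for $n\ge 1$. For $\beta,\delta\in\mathbb{C}\setminus\mathbb{Z}_0^-$ the Kampé de Fériet function used here is $$F^{1:1;2}_{1:0;1}\left[\begin{array}{rrr}\alpha:&\epsilon;&b_1,\,b_2;\\ \beta:&-;&\delta;\end{array}x,y\right]=\sum_{m=0}^\infty\sum_{n=0}^\infty\frac{(\alpha)_{m+n}(\epsilon)_m(b_1)_n(b_2)_n}{(\beta)_{m+n}(\delta)_n}\,\frac{x^m}{m!}\,\frac{y^n}{n!}.$$ Assume $\beta\notin\mathbb{Z}_0^-$. Below, the reciprocal $1/\Gamma$ of a Gamma function in a denominator is read as $0$ at the poles of $\Gamma$. (1) If $1-\alpha-\epsilon+\beta+i\notin\mathbb{Z}_0^-$, $\alpha-i\notin\mathbb{Z}_0^-$ and $\frac{1-2\alpha-\epsilon+\beta+i+r}{2}\notin\mathbb{Z}_0^-$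 for $r=0,\dots,i$, then the double series below converges absolutely and $$F^{1:1;2}_{1:0;1}\left[\begin{array}{rrr}\alpha:&\epsilon;&\beta-\epsilon,\,1-\alpha-\epsilon+i;\\ \beta:&-;&1-\alpha-\epsilon+\beta+i;\end{array}\tfrac12,\tfrac12\right]=\frac{2^{i-\alpha}\,\Gamma(\beta-\epsilon-\alpha+i+1)\,\Gamma(\alpha-i)}{\Gamma(1-2\alpha-\epsilon+\beta+i)\,\Gamma(\alpha)}\sum_{r=0}^{i}(-1)^r\binom ir\frac{\Gamma\left(\frac{1-2\alpha-\epsilon+\beta+i+r}{2}\right)}{\Gamma\left(\frac{\beta-\epsilon-i+r+1}{2}\right)}.$$ (2) If $1-\alpha-\epsilon+\beta-i\notin\mathbb{Z}_0^-$ and $\frac{1-2\alpha-\epsilon+\beta-i+r}{2}\notin\mathbb{Z}_0^-$ for $r=0,\dots,i$, then the double series below converges absolutely and $$F^{1:1;2}_{1:0;1}\left[\begin{array}{rrr}\alpha:&\epsilon;&\beta-\epsilon,\,1-\alpha-\epsilon-i;\\ \beta:&-;&1-\alpha-\epsilon+\beta-i;\end{array}\tfrac12,\tfrac12\right]=\frac{2^{-\alpha-i}\,\Gamma(\beta-\epsilon-\alpha-i+1)}{\Gamma(1-2\alpha-\epsilon+\beta-i)}\sum_{r=0}^{i}\binom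 ir\frac{\Gamma\left(\frac{1-2\alpha-\epsilon+\beta-i+r}{2}\right)}{\Gamma\left(\frac{\beta-\epsilon-i+r+1}{2}\right)}.$$ -/

import Mathlib

open scoped BigOperators

noncomputable section

/-- The product `(a₁)ₙ (a₂)ₙ ⋯ (a_k)ₙ` of the Pochhammer symbols
`(a)ₙ = a (a + 1) ⋯ (a + n - 1)` over a finite sequence of parameters
(equal to `1` for the empty sequence). -/
def pochhammerProd (a : List ℂ) (n : ℕ) : ℂ :=
  (a.map fun c => (ascPochhammer ℂ n).eval c).prod

/-- The `(m, n)`-th term of the double series defining the generalized Kampé de Fériet function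
`F^{H:A;B}_{G:C;D}[(h) : (a) ; (b) ; (g) : (c) ; (d) ; x, y]`. -/
def kampeDeFerietTerm (h a b g c d : List ℂ) (x y : ℂ) (m n : ℕ) : ℂ :=
  (pochhammerProd h (m + n) * pochhammerProd a m * pochhammerProd b n) /
      (pochhammerProd g (m + n) * pochhammerProd c m * pochhammerProd d n) *
    (x ^ m / (m.factorial : ℂ)) * (y ^ n / (n.factorial : ℂ))

/-- The generalized Kampé de Fériet function
`F^{H:A;B}_{G:C;D}[(h) : (a) ; (b) ; (g) : (c) ; (d) ; x, y]`, as an iterated double series. -/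
def kampeDeFeriet (h a b g c d : List ℂ) (x y : ℂ) : ℂ :=
  ∑' m : ℕ, ∑' n : ℕ, kampeDeFerietTerm h a b g c d x y m n

end

section KampeDeFerietAux

open Filter Topology Finset

/-! Since both arguments equal 1/2, the double series can be summed along the antidiagonals m + n =
N, where (α)_N / (β)_N and 2^(-N) are constant. The remaining finite sum is Saalschützian because δ
= b + β, where b is the last upper parameter; `sum_antidiagonal_saalschutz` evaluates it and
produces a factor (β)_N that cancels. What is left is the Gauss series ₂F₁(α, b + ε; δ; 1/2)
(`kampeDeFeriet_eq_gaussHalf`), and b = 1 - α - ε ± i makes its second parameter 1 - α ± i.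

For i = 0 this is Bailey's theorem (`gaussHalf_one_sub`): both sides, divided by Γ(c), obey the same
recurrence c → c + 2, and after multiplication by Γ(c) both tend to 1 far to the right. For general
i, contiguous relations move i by one, and Pascal's rule assembles the resulting Gamma quotients
into the binomial sums. -/

/-- The rising factorial `(a)ₙ = a (a + 1) ⋯ (a + n - 1)`. -/
noncomputable def rising (a : ℂ) (n : ℕ) : ℂ := (ascPochhammer ℂ n).eval a

@[simp] lemma rising_zero (a : ℂ) : rising a 0 = 1 := by simp [rising]

lemma rising_succ (a : ℂ) (n : ℕ) : rising a (n + 1) = rising a n * (a + n) :=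
  ascPochhammer_succ_eval n a

lemma rising_succ' (a : ℂ) (n : ℕ) : rising a (n + 1) = a * rising (a + 1) n := by
  simp [rising, ascPochhammer_succ_left, Polynomial.eval_comp]

lemma mul_rising_add_one (a : ℂ) (n : ℕ) : a * rising (a + 1) n = rising a n * (a + n) := by
  rw [← rising_succ', rising_succ]

lemma rising_add (a : ℂ) (m n : ℕ) : rising a (m + n) = rising a m * rising (a + m) n := by
  induction n with
  | zero => simp
  | succ n ih => rw [← add_assoc, rising_succ, ih, rising_succ]; push_cast; ring

lemma rising_ne_zero {a : ℂ} (ha : ∀ k : ℕ, a ≠ -(k : ℂ)) (n : ℕ) : rising a n ≠ 0 := by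
  induction n with
  | zero => simp
  | succ n ih =>
    rw [rising_succ]
    exact mul_ne_zero ih fun h => ha n (eq_neg_of_add_eq_zero_left h)

lemma Gamma_add_natCast_eq_rising {c : ℂ} (hc : ∀ k : ℕ, c ≠ -(k : ℂ)) (n : ℕ) :
    Complex.Gamma (c + n) = Complex.Gamma c * rising c n := by
  rw [rising, ← Complex.Gamma_add_nat_div_Gamma_eq c hc,
    mul_div_cancel₀ _ (Complex.Gamma_ne_zero hc)]

/-! ### Pfaff–Saalschütz summation, by recursion on N. -/

section Saalschutz

/-- The summand of the terminating Saalschützian series, in polynomial form. -/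
noncomputable def saalschutzTerm (e f c : ℂ) (p : ℕ × ℕ) : ℂ :=
  rising e p.1 * rising f p.2 * rising c p.2 * rising (c + e + f + p.2) p.1 /
    (p.1.factorial * p.2.factorial)

/-- The antidiagonal sum of `saalschutzTerm`. -/
noncomputable def saalschutzSum (e f c : ℂ) (N : ℕ) : ℂ :=
  ∑ p ∈ antidiagonal N, saalschutzTerm e f c p

lemma saalschutzTerm_succ_left (e f c : ℂ) (m n : ℕ) :
    (m + 1 : ℂ) * saalschutzTerm e f c (m + 1, n) =
      e * (c + e + f + n) * saalschutzTerm (e + 1) f c (m, n) := by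
  have h1 : (m + 1 : ℂ) ≠ 0 := by exact_mod_cast m.succ_ne_zero
  have h2 : (m.factorial : ℂ) ≠ 0 := by exact_mod_cast m.factorial_ne_zero
  have h3 : (n.factorial : ℂ) ≠ 0 := by exact_mod_cast n.factorial_ne_zero
  simp only [saalschutzTerm, rising_succ', Nat.factorial_succ]
  rw [show c + (e + 1) + f + n = c + e + f + n + 1 by ring]
  push_cast
  field_simp

lemma saalschutzTerm_succ_right (e f c : ℂ) (m n : ℕ) :
    (n + 1 : ℂ) * saalschutzTerm e f c (m, n + 1) =
      rising e m * rising f n * rising c n * rising (c + e + f + n + 1) m *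
        ((f + n) * (c + n)) / (m.factorial * n.factorial) := by
  have h1 : (n + 1 : ℂ) ≠ 0 := by exact_mod_cast n.succ_ne_zero
  have h2 : (m.factorial : ℂ) ≠ 0 := by exact_mod_cast m.factorial_ne_zero
  have h3 : (n.factorial : ℂ) ≠ 0 := by exact_mod_cast n.factorial_ne_zero
  simp only [saalschutzTerm, rising_succ, Nat.factorial_succ]
  push_cast
  rw [show c + e + f + (n + 1 : ℂ) = c + e + f + n + 1 by ring]
  field_simp

/-- On the antidiagonal the weight N + 1 splits as p.1 + p.2, and each half loses its vanishing end
term. The weights cancel factorials later. -/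
lemma weighted_sum_antidiagonal (g : ℕ × ℕ → ℂ) (N : ℕ) :
    (N + 1 : ℂ) * ∑ p ∈ antidiagonal (N + 1), g p =
      ∑ p ∈ antidiagonal N,
        ((p.1 + 1 : ℂ) * g (p.1 + 1, p.2) + (p.2 + 1 : ℂ) * g (p.1, p.2 + 1)) := by
  have h : (N + 1 : ℂ) * ∑ p ∈ antidiagonal (N + 1), g p =
      ∑ p ∈ antidiagonal (N + 1), (p.1 : ℂ) * g p + ∑ p ∈ antidiagonal (N + 1), (p.2 : ℂ) * g p := by
    rw [mul_sum, ← sum_add_distrib]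
    refine sum_congr rfl fun p hp => ?_
    rw [HasAntidiagonal.mem_antidiagonal] at hp
    rw [← add_mul, ← Nat.cast_add, hp]
    push_cast; rfl
  rw [h, Nat.sum_antidiagonal_succ, Nat.sum_antidiagonal_succ', sum_add_distrib]
  simp

lemma saalschutzSum_zero (e f c : ℂ) : saalschutzSum e f c 0 = 1 := by
  simp [saalschutzSum, saalschutzTerm]

/-- The summand left over from the recursion for `saalschutzSum`. -/
noncomputable def saalschutzDefect (e f c : ℂ) (p : ℕ × ℕ) : ℂ :=
  rising f p.2 * rising c p.2 * rising (c + e + f + p.2 + 1) p.1 *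
    (p.2 * rising e p.1 * (c + e + f + p.1 + p.2) -
      f * c * (rising (e + 1) p.1 - rising e p.1)) / (p.1.factorial * p.2.factorial)

lemma saalschutzSum_succ_sub (e f c : ℂ) (N : ℕ) :
    (N + 1 : ℂ) * saalschutzSum e f c (N + 1) - (c + e) * (e + f) * saalschutzSum (e + 1) f c N =
      ∑ p ∈ antidiagonal N, saalschutzDefect e f c p := by
  rw [saalschutzSum, weighted_sum_antidiagonal, saalschutzSum, mul_sum, ← sum_sub_distrib]
  refine sum_congr rfl fun p _ => ?_
  obtain ⟨m, n⟩ := p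
  rw [saalschutzTerm_succ_left, saalschutzTerm_succ_right]
  simp only [saalschutzTerm, saalschutzDefect]
  rw [show c + (e + 1) + f + n = c + e + f + n + 1 by ring]
  have h2 : (m.factorial : ℂ) ≠ 0 := by exact_mod_cast m.factorial_ne_zero
  have h3 : (n.factorial : ℂ) ≠ 0 := by exact_mod_cast n.factorial_ne_zero
  field_simp
  linear_combination rising f n * rising c n * rising (c + e + f + n + 1) m * n *
    mul_rising_add_one e m

lemma rising_add_one_sub (e : ℂ) (m : ℕ) :
    rising (e + 1) (m + 1) - rising e (m + 1) = (m + 1) * rising (e + 1) m := by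
  rw [rising_succ, rising_succ']; ring

lemma sum_saalschutzDefect_zero (e f c : ℂ) :
    ∑ p ∈ antidiagonal 0, saalschutzDefect e f c p = 0 := by
  simp [saalschutzDefect]

/-- Each of the two pieces of the defect vanishes at one end of the antidiagonal; shifting the other
index turns it into a shorter Saalschütz sum. -/
lemma sum_saalschutzDefect_succ (e f c : ℂ) (N : ℕ) :
    ∑ p ∈ antidiagonal (N + 1), saalschutzDefect e f c p =
      f * c * (c + e + f + N + 1) *
        (saalschutzSum e (f + 1) (c + 1) N - saalschutzSum (e + 1) f c N) := by
  have hN : (N + 1 : ℂ) ≠ 0 := by exact_mod_cast N.succ_ne_zero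
  have split : ∀ p, saalschutzDefect e f c p =
      rising f p.2 * rising c p.2 * rising (c + e + f + p.2 + 1) p.1 *
        (p.2 * rising e p.1 * (c + e + f + p.1 + p.2)) / (p.1.factorial * p.2.factorial) -
      rising f p.2 * rising c p.2 * rising (c + e + f + p.2 + 1) p.1 *
        (f * c * (rising (e + 1) p.1 - rising e p.1)) / (p.1.factorial * p.2.factorial) := by
    intro p
    rw [saalschutzDefect]; ring
  simp only [split, sum_sub_distrib]
  rw [Nat.sum_antidiagonal_succ', Nat.sum_antidiagonal_succ]
  simp only [Nat.cast_zero, zero_mul, mul_zero, zero_div, zero_add, rising_zero, sub_self, mul_sub,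
    saalschutzSum, mul_sum]
  congr 1
  · refine sum_congr rfl fun p hp => ?_
    obtain ⟨m, n⟩ := p
    have hp : (m : ℂ) + n = N := by exact_mod_cast HasAntidiagonal.mem_antidiagonal.1 hp
    have h1 : (n + 1 : ℂ) ≠ 0 := by exact_mod_cast n.succ_ne_zero
    have h2 : (m.factorial : ℂ) ≠ 0 := by exact_mod_cast m.factorial_ne_zero
    have h3 : (n.factorial : ℂ) ≠ 0 := by exact_mod_cast n.factorial_ne_zero
    simp only [saalschutzTerm, rising_succ', Nat.factorial_succ, ← hp]
    push_cast
    rw [show c + 1 + e + (f + 1) + n = c + e + f + (n + 1) + 1 by ring]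
    field_simp
    ring
  · refine sum_congr rfl fun p hp => ?_
    obtain ⟨m, n⟩ := p
    have hp : (m : ℂ) + n = N := by exact_mod_cast HasAntidiagonal.mem_antidiagonal.1 hp
    have h1 : (m + 1 : ℂ) ≠ 0 := by exact_mod_cast m.succ_ne_zero
    have h2 : (m.factorial : ℂ) ≠ 0 := by exact_mod_cast m.factorial_ne_zero
    have h3 : (n.factorial : ℂ) ≠ 0 := by exact_mod_cast n.factorial_ne_zero
    simp only [← mul_sub, rising_add_one_sub]
    simp only [saalschutzTerm, rising_succ, Nat.factorial_succ, ← hp]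
    push_cast
    rw [show c + (e + 1) + f + n = c + e + f + n + 1 by ring]
    field_simp
    ring

/-- Strong induction is needed because the defect involves sums two steps down. By induction those
two sums have the same closed form, so the defect vanishes and a first-order recursion remains. -/
lemma saalschutzSum_eq (N : ℕ) : ∀ e f c : ℂ,
    saalschutzSum e f c N = rising (c + e) N * rising (e + f) N / N.factorial := by
  induction N using Nat.strong_induction_on with
  | _ N ih =>
    intro e f c
    rcases N with _ | N
    · simp [saalschutzSum_zero]
    · have hN : (N + 1 : ℂ) ≠ 0 := by exact_mod_cast N.succ_ne_zero
      have h2 : (N.factorial : ℂ) ≠ 0 := by exact_mod_cast N.factorial_ne_zero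
      have hdef : ∑ p ∈ antidiagonal N, saalschutzDefect e f c p = 0 := by
        rcases N with _ | N
        · exact sum_saalschutzDefect_zero e f c
        · rw [sum_saalschutzDefect_succ, ih N (by omega), ih N (by omega)]
          rw [show c + 1 + e = c + (e + 1) by ring, show e + (f + 1) = e + 1 + f by ring]
          ring
      have h := saalschutzSum_succ_sub e f c N
      rw [hdef, ih N (by omega), sub_eq_zero] at h
      rw [← mul_right_inj' hN, h, rising_succ', rising_succ', Nat.factorial_succ]
      rw [show c + (e + 1) = c + e + 1 by ring, show e + 1 + f = e + f + 1 by ring]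
      push_cast
      field_simp

/-- The **Pfaff–Saalschütz theorem**. -/
theorem sum_antidiagonal_saalschutz (e f c : ℂ) (hd : ∀ k : ℕ, c + e + f ≠ -(k : ℂ)) (N : ℕ) :
    ∑ p ∈ antidiagonal N, rising e p.1 * rising f p.2 * rising c p.2 /
        (rising (c + e + f) p.2 * (p.1.factorial * p.2.factorial)) =
      rising (c + e) N * rising (e + f) N / (rising (c + e + f) N * N.factorial) := by
  have h := saalschutzSum_eq N e f c
  have hN := rising_ne_zero hd N
  -- Dividing the polynomial identity by (c + e + f)_N recovers the usual form, since (d)_N = (d)_n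
  -- (d + n)_m for N = m + n.
  rw [mul_comm (rising (c + e + f) N), ← div_div, ← h, saalschutzSum, sum_div]
  refine sum_congr rfl fun p hp => ?_
  rw [← HasAntidiagonal.mem_antidiagonal.1 hp, add_comm p.1, rising_add, saalschutzTerm]
  have h1 := rising_ne_zero hd p.2
  have h4 : rising (c + e + f + p.2) p.1 ≠ 0 := by
    have := rising_ne_zero hd (p.2 + p.1)
    rw [rising_add] at this
    exact right_ne_zero_of_mul this
  have h2 : (p.1.factorial : ℂ) ≠ 0 := by exact_mod_cast p.1.factorial_ne_zero
  have h3 : (p.2.factorial : ℂ) ≠ 0 := by exact_mod_cast p.2.factorial_ne_zero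
  field_simp

end Saalschutz

/-! ### Ratio tests. -/

lemma summable_of_eventually_ratio_tendsto {u q : ℕ → ℂ} {l : ℂ}
    (h : ∀ᶠ n in atTop, u (n + 1) = q n * u n) (hq : Tendsto q atTop (𝓝 l)) (hl : ‖l‖ < 1) :
    Summable u := by
  obtain ⟨r, hr, hr1⟩ := exists_between hl
  refine summable_of_ratio_norm_eventually_le hr1 ?_
  filter_upwards [h, hq.norm.eventually (ge_mem_nhds hr)] with n hn hn'
  rw [hn, norm_mul]
  gcongr

lemma summable_mul_pow_of_ratio_tendsto_one {u q : ℕ → ℂ}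
    (h : ∀ᶠ n in atTop, u (n + 1) = q n * u n) (hq : Tendsto q atTop (𝓝 1)) {z : ℂ}
    (hz : ‖z‖ < 1) : Summable fun n => u n * z ^ n := by
  refine summable_of_eventually_ratio_tendsto (q := fun n => q n * z) (l := 1 * z) ?_
    (hq.mul_const z) (by simpa using hz)
  filter_upwards [h] with n hn
  rw [hn]; ring

lemma tendsto_add_natCast_div (a b : ℂ) :
    Tendsto (fun n : ℕ => (a + n) / (b + n)) atTop (𝓝 1) := by
  have h : ∀ x : ℂ, Tendsto (fun n : ℕ => x / n + 1) atTop (𝓝 1) := fun x => by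
    simpa using (tendsto_const_div_atTop_nhds_zero_nat x).add_const 1
  have := (h a).div (h b) one_ne_zero
  rw [div_one] at this
  refine this.congr' ?_
  filter_upwards [eventually_ne_atTop 0] with n hn
  have hn : (n : ℂ) ≠ 0 := by exact_mod_cast hn
  simp only [Pi.div_apply]
  rw [← mul_div_mul_right _ _ hn, add_mul, add_mul, div_mul_cancel₀ _ hn, div_mul_cancel₀ _ hn,
    one_mul]

lemma eventually_add_natCast_ne_zero (c : ℂ) : ∀ᶠ n : ℕ in atTop, c + n ≠ 0 := by
  by_cases h : ∃ k : ℕ, c = -(k : ℂ)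
  · obtain ⟨k, rfl⟩ := h
    filter_upwards [eventually_gt_atTop k] with n hn h0
    rw [neg_add_eq_zero] at h0
    have : k = n := by exact_mod_cast h0
    omega
  · refine Eventually.of_forall fun n hn => h ⟨n, eq_neg_of_add_eq_zero_left hn⟩

/-! ### The regularized Gauss series at 1/2 and its contiguous relations. -/

/-- The `n`-th term of the regularized Gauss series `₂F₁(a, b; c; 1/2) / Γ(c)`. -/
noncomputable def gaussHalfTerm (a b c : ℂ) (n : ℕ) : ℂ :=
  rising a n * rising b n * (Complex.Gamma (c + n))⁻¹ / n.factorial * (1 / 2) ^ n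

/-- The regularized Gauss series `₂F₁(a, b; c; 1/2) / Γ(c)`. -/
noncomputable def gaussHalf (a b c : ℂ) : ℂ := ∑' n, gaussHalfTerm a b c n

/-- Every c is allowed: `Complex.Gamma` is 0 at its poles, so its inverse agrees with the entire
function 1/Γ. The ratio recursion may fail where c + n = 0, hence holds only eventually. -/
lemma summable_gaussHalfTerm (a b c : ℂ) : Summable (gaussHalfTerm a b c) := by
  refine summable_mul_pow_of_ratio_tendsto_one
    (q := fun n => (a + n) / (c + n) * ((b + n) / (1 + n))) ?_ ?_ (by norm_num)
  · filter_upwards [eventually_add_natCast_ne_zero c] with n hn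
    have h1 : (1 + n : ℂ) ≠ 0 := by rw [add_comm]; exact_mod_cast n.succ_ne_zero
    have h2 : (n.factorial : ℂ) ≠ 0 := by exact_mod_cast n.factorial_ne_zero
    have h := Complex.one_div_Gamma_eq_self_mul_one_div_Gamma_add_one (c + n)
    rw [rising_succ, rising_succ, Nat.factorial_succ, h]
    push_cast
    rw [add_assoc c, add_comm (n : ℂ) 1]
    field_simp
  · simpa using (tendsto_add_natCast_div a c).mul (tendsto_add_natCast_div b 1)

lemma gaussHalfTerm_zero (a b c : ℂ) : gaussHalfTerm a b c 0 = (Complex.Gamma c)⁻¹ := by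
  simp [gaussHalfTerm]

lemma gaussHalfTerm_eq_mul_add_one (a b c : ℂ) (n : ℕ) :
    gaussHalfTerm a b c n = (c + n) * gaussHalfTerm a b (c + 1) n := by
  rw [gaussHalfTerm, gaussHalfTerm, Complex.one_div_Gamma_eq_self_mul_one_div_Gamma_add_one,
    add_right_comm]
  ring

lemma gaussHalfTerm_succ (a b c : ℂ) (n : ℕ) :
    gaussHalfTerm a b c (n + 1) * (2 * (n + 1)) =
      (a + n) * (b + n) * gaussHalfTerm a b (c + 1) n := by
  have h1 : (n + 1 : ℂ) ≠ 0 := by exact_mod_cast n.succ_ne_zero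
  have h2 : (n.factorial : ℂ) ≠ 0 := by exact_mod_cast n.factorial_ne_zero
  rw [gaussHalfTerm, gaussHalfTerm, rising_succ, rising_succ, Nat.factorial_succ, pow_succ]
  push_cast
  rw [show c + ((n : ℂ) + 1) = c + 1 + n by ring]
  field_simp

lemma gaussHalf_sub_one (a b c : ℂ) :
    gaussHalf a (b - 1) c = (gaussHalf a b c + (c - a) * gaussHalf a b (c + 1)) / 2 := by
  have hs := fun b c => summable_gaussHalfTerm a b c
  have key : ∀ n, gaussHalfTerm a b c (n + 1) - gaussHalfTerm a (b - 1) c (n + 1) =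
      (gaussHalfTerm a b c n - (c - a) * gaussHalfTerm a b (c + 1) n) / 2 := by
    intro n
    have h1 : (n + 1 : ℂ) ≠ 0 := by exact_mod_cast n.succ_ne_zero
    have h2 : (n.factorial : ℂ) ≠ 0 := by exact_mod_cast n.factorial_ne_zero
    rw [gaussHalfTerm_eq_mul_add_one a b c n]
    simp only [gaussHalfTerm]
    rw [rising_succ b, rising_succ' (b - 1), rising_succ a, sub_add_cancel, Nat.factorial_succ,
      pow_succ]
    push_cast
    rw [show c + ((n : ℂ) + 1) = c + 1 + n by ring]
    field_simp
    ring
  have h := ((hs b c).sub (hs (b - 1) c)).tsum_eq_zero_add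
  rw [(hs b c).tsum_sub (hs (b - 1) c), tsum_congr key, tsum_div_const,
    (hs b c).tsum_sub ((hs b (c + 1)).mul_left _), tsum_mul_left] at h
  simp only [gaussHalfTerm_zero, sub_self, zero_add] at h
  simp only [gaussHalf]
  linear_combination -h

lemma sub_one_mul_gaussHalf (a b c : ℂ) :
    (a - 1) * gaussHalf a b c =
      gaussHalf (a - 1) b (c - 1) - (c - a) * gaussHalf (a - 1) b c := by
  have hs := fun a c => summable_gaussHalfTerm a b c
  simp only [gaussHalf]
  rw [← tsum_mul_left, ← tsum_mul_left, ← (hs _ _).tsum_sub ((hs _ _).mul_left _)]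
  refine tsum_congr fun n => ?_
  rw [gaussHalfTerm_eq_mul_add_one (a - 1) b (c - 1), sub_add_cancel]
  simp only [gaussHalfTerm]
  have h := mul_rising_add_one (a - 1) n
  rw [sub_add_cancel] at h
  linear_combination (rising b n * (Complex.Gamma (c + n))⁻¹ / n.factorial * (1 / 2) ^ n) * h

/-- The termwise difference of the two sides telescopes, with certificate G n = 2n times the n-th
term at c + 1, and G 0 = 0. -/
lemma gaussHalf_one_sub_eq_mul_add_two (a c : ℂ) :
    gaussHalf a (1 - a) c = (c + a) * (c + 1 - a) * gaussHalf a (1 - a) (c + 2) := by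
  have hs := fun a b c => summable_gaussHalfTerm a b c
  set G : ℕ → ℂ := fun n => 2 * n * gaussHalfTerm a (1 - a) (c + 1) n with hG
  have hG2 : ∀ n, G (n + 1) = (a + n) * (1 - a + n) * gaussHalfTerm a (1 - a) (c + 2) n := by
    intro n
    have h := gaussHalfTerm_succ a (1 - a) (c + 1) n
    rw [show c + 1 + 1 = c + 2 by ring] at h
    rw [← h, hG]; push_cast; ring
  -- Recognising G as a multiple of another Gauss term gives its summability.
  have hG1 : ∀ n, G (n + 1) = a * (1 - a) * gaussHalfTerm (a + 1) (1 - a + 1) (c + 2) n := by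
    intro n
    rw [hG2]
    simp only [gaussHalfTerm]
    linear_combination (-(Complex.Gamma (c + 2 + n))⁻¹ / n.factorial * (1 / 2) ^ n) *
      (mul_rising_add_one a n * ((1 - a) * rising (1 - a + 1) n) +
        rising a n * (a + n) * mul_rising_add_one (1 - a) n)
  have hGs : Summable G := by
    rw [← summable_nat_add_iff 1]
    simp only [hG1]
    exact (hs _ _ _).mul_left _
  have key : ∀ n, gaussHalfTerm a (1 - a) c n -
      (c + a) * (c + 1 - a) * gaussHalfTerm a (1 - a) (c + 2) n = G n - G (n + 1) := by
    intro n
    rw [hG2, hG, gaussHalfTerm_eq_mul_add_one _ _ c]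
    simp only
    rw [gaussHalfTerm_eq_mul_add_one _ _ (c + 1), show c + 1 + 1 = c + 2 by ring]
    ring
  have h0 : ∑' n, (G n - G (n + 1)) = 0 := by
    rw [hGs.tsum_sub ((summable_nat_add_iff 1).2 hGs), hGs.tsum_eq_zero_add]
    simp [hG]
  rw [← tsum_congr key, (hs _ _ _).tsum_sub ((hs _ _ _).mul_left _), tsum_mul_left] at h0
  exact sub_eq_zero.1 h0

/-! ### Asymptotics as c moves to the right, and Bailey's theorem. -/

lemma ne_neg_natCast_of_re_pos {s : ℂ} (hs : 0 < s.re) (k : ℕ) : s ≠ -(k : ℂ) := by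
  rintro rfl
  have : (0 : ℝ) ≤ k := k.cast_nonneg
  simp at hs
  linarith

lemma norm_rising_ofReal_le {x : ℝ} (hx : 0 < x) {c : ℂ} (hc : x ≤ c.re) (n : ℕ) :
    ‖rising x n‖ ≤ ‖rising c n‖ := by
  induction n with
  | zero => simp
  | succ n ih =>
    rw [rising_succ, rising_succ, norm_mul, norm_mul]
    gcongr
    have h : ((x : ℂ) + n) = ((x + n : ℝ) : ℂ) := by push_cast; rfl
    rw [h, Complex.norm_real, Real.norm_of_nonneg (by positivity)]
    refine le_trans ?_ (Complex.re_le_norm _)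
    simpa using hc

lemma tendsto_norm_rising_add_two_mul {c : ℂ} (hc : 0 < c.re) (n : ℕ) :
    Tendsto (fun k : ℕ => ‖rising (c + 2 * k) (n + 1)‖) atTop atTop := by
  have hpos : 0 < ‖rising (c.re : ℂ) n‖ :=
    norm_pos_iff.2 (rising_ne_zero (ne_neg_natCast_of_re_pos (by simpa using hc)) n)
  refine tendsto_atTop_mono (f := fun k : ℕ => (k : ℝ) * ‖rising (c.re : ℂ) n‖) (fun k => ?_)
    (tendsto_natCast_atTop_atTop.atTop_mul_const hpos)
  rw [rising_succ', norm_mul]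
  have hk : (0 : ℝ) ≤ k := k.cast_nonneg
  gcongr
  · refine le_trans ?_ (Complex.re_le_norm _)
    simp
    linarith
  · refine norm_rising_ofReal_le hc ?_ n
    simp
    linarith

lemma Gamma_mul_gaussHalfTerm {c : ℂ} (hc : ∀ k : ℕ, c ≠ -(k : ℂ)) (a b : ℂ) (n : ℕ) :
    Complex.Gamma c * gaussHalfTerm a b c n =
      rising a n * rising b n / (rising c n * n.factorial) * (1 / 2) ^ n := by
  have h1 := Complex.Gamma_ne_zero hc
  have h2 := rising_ne_zero hc n
  rw [gaussHalfTerm, Gamma_add_natCast_eq_rising hc]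
  field_simp

/-- Every term with n ≥ 1 tends to 0, and the series at the real parameter Re c dominates. -/
lemma tendsto_Gamma_mul_gaussHalf (a b : ℂ) {c : ℂ} (hc : 0 < c.re) :
    Tendsto (fun k : ℕ => Complex.Gamma (c + 2 * k) * gaussHalf a b (c + 2 * k)) atTop (𝓝 1) := by
  have hre : ∀ k : ℕ, c.re ≤ (c + 2 * k).re := fun k => by simp
  have hp : ∀ k : ℕ, ∀ j : ℕ, c + 2 * k ≠ -(j : ℂ) := fun k =>
    ne_neg_natCast_of_re_pos (hc.trans_le (hre k))
  have hx : ∀ j : ℕ, (c.re : ℂ) ≠ -(j : ℂ) := ne_neg_natCast_of_re_pos (by simpa using hc)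
  have hlim : ∑' n : ℕ, (if n = 0 then (1 : ℂ) else 0) = 1 := by simp
  rw [← hlim]
  simp only [gaussHalf, ← tsum_mul_left]
  refine tendsto_tsum_of_dominated_convergence
    (bound := fun n => ‖Complex.Gamma c.re * gaussHalfTerm a b c.re n‖)
    ((summable_gaussHalfTerm a b c.re).mul_left _).norm (fun n => ?_)
    (Eventually.of_forall fun k n => ?_)
  · simp only [Gamma_mul_gaussHalfTerm (hp _)]
    rcases n with _ | n
    · simp
    · rw [if_neg n.succ_ne_zero, tendsto_zero_iff_norm_tendsto_zero]
      refine ((tendsto_norm_rising_add_two_mul hc n).const_div_atTop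
        (‖rising a (n + 1) * rising b (n + 1) / (n + 1).factorial * (1 / 2) ^ (n + 1)‖)).congr
        fun k => ?_
      rw [← norm_div]
      congr 1
      ring
  · rw [Gamma_mul_gaussHalfTerm (hp _), Gamma_mul_gaussHalfTerm hx]
    simp only [norm_mul, norm_div]
    have : 0 < ‖rising (c.re : ℂ) n‖ := norm_pos_iff.2 (rising_ne_zero hx n)
    gcongr
    · exact mul_pos this (by simpa using Nat.factorial_pos n)
    · exact norm_rising_ofReal_le hc (hre k) n

lemma rising_eq_prod (a : ℂ) (n : ℕ) : rising a n = ∏ j ∈ range n, (a + j) := by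
  induction n with
  | zero => simp
  | succ n ih => rw [rising_succ, ih, prod_range_succ]

lemma tendsto_Gamma_add_div {s : ℂ} (hs : ∀ k : ℕ, s ≠ -(k : ℂ)) :
    Tendsto (fun n : ℕ => Complex.Gamma (s + (n + 1 : ℕ)) / ((n : ℂ) ^ s * n.factorial))
      atTop (𝓝 1) := by
  have h0 := Complex.Gamma_ne_zero hs
  have h := (tendsto_const_nhds (x := Complex.Gamma s)).div (Complex.GammaSeq_tendsto_Gamma s) h0
  rw [div_self h0] at h
  refine h.congr fun n => ?_
  rw [Pi.div_apply, Complex.GammaSeq, Gamma_add_natCast_eq_rising hs, rising_eq_prod,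
    div_div_eq_mul_div]

/-- The right-hand side of Bailey's summation theorem, divided by `Γ(c)`. -/
noncomputable def baileyValue (a c : ℂ) : ℂ :=
  (2 : ℂ) ^ (1 - c) * (√Real.pi : ℝ) * (Complex.Gamma ((c + a) / 2))⁻¹ *
    (Complex.Gamma ((c + 1 - a) / 2))⁻¹

lemma baileyValue_eq_mul_add_two (a c : ℂ) :
    baileyValue a c = (c + a) * (c + 1 - a) * baileyValue a (c + 2) := by
  rw [baileyValue, baileyValue,
    Complex.one_div_Gamma_eq_self_mul_one_div_Gamma_add_one ((c + a) / 2),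
    Complex.one_div_Gamma_eq_self_mul_one_div_Gamma_add_one ((c + 1 - a) / 2),
    show (c + a) / 2 + 1 = (c + 2 + a) / 2 by ring,
    show (c + 1 - a) / 2 + 1 = (c + 2 + 1 - a) / 2 by ring,
    show 1 - c = 1 - (c + 2) + 2 by ring, Complex.cpow_add _ _ two_ne_zero, Complex.cpow_ofNat]
  ring

lemma Gamma_mul_baileyValue (a s : ℂ) :
    Complex.Gamma (2 * s) * baileyValue a (2 * s) =
      Complex.Gamma s * Complex.Gamma (s + 1 / 2) /
        (Complex.Gamma (s + a / 2) * Complex.Gamma (s + (1 - a) / 2)) := by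
  rw [Complex.Gamma_mul_Gamma_add_half, baileyValue, show (2 * s + a) / 2 = s + a / 2 by ring,
    show (2 * s + 1 - a) / 2 = s + (1 - a) / 2 by ring]
  field_simp

/-- By duplication this is a quotient of two Gamma products; Γ(z + k + 1) ~ k^z k!, and the
exponents z have equal sums above and below. -/
lemma tendsto_Gamma_mul_baileyValue {a s : ℂ} (h0 : 0 < s.re) (h1 : 0 < (s + a / 2).re)
    (h2 : 0 < (s + (1 - a) / 2).re) :
    Tendsto (fun k : ℕ => Complex.Gamma (2 * s + 2 * (k + 1 : ℕ)) *
      baileyValue a (2 * s + 2 * (k + 1 : ℕ))) atTop (𝓝 1) := by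
  have h0' : 0 < (s + 1 / 2).re := by
    rw [Complex.add_re]
    have : (0 : ℝ) < (1 / 2 : ℂ).re := by norm_num
    linarith
  have g : ∀ {s : ℂ}, 0 < s.re → _ := fun hs =>
    tendsto_Gamma_add_div (ne_neg_natCast_of_re_pos hs)
  have h := ((g h0).mul (g h0')).div ((g h1).mul (g h2)) (by simp)
  simp only [mul_one, div_one] at h
  refine h.congr' ?_
  filter_upwards [eventually_ne_atTop 0] with k hk
  have hk : (k : ℂ) ≠ 0 := by exact_mod_cast hk
  rw [← mul_add, Gamma_mul_baileyValue]
  have hf : (k.factorial : ℂ) ≠ 0 := by exact_mod_cast k.factorial_ne_zero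
  have hp : ∀ z : ℂ, (k : ℂ) ^ z ≠ 0 := fun z => by simp [Complex.cpow_eq_zero_iff, hk]
  have e : (k : ℂ) ^ s * (k : ℂ) ^ (s + 1 / 2) =
      (k : ℂ) ^ (s + a / 2) * (k : ℂ) ^ (s + (1 - a) / 2) := by
    rw [← Complex.cpow_add _ _ hk, ← Complex.cpow_add _ _ hk]
    congr 1; ring
  simp only [Pi.div_apply]
  rw [div_mul_div_comm, div_mul_div_comm, div_div_div_comm]
  simp only [add_right_comm s]
  rw [mul_mul_mul_comm ((k : ℂ) ^ s), mul_mul_mul_comm ((k : ℂ) ^ (s + a / 2)), e,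
    div_self (mul_ne_zero (mul_ne_zero (hp _) (hp _)) (mul_ne_zero hf hf)), div_one]

/-- Sharing one P avoids dividing by it, as it may vanish. -/
lemma exists_common_factor (a c : ℂ) (k : ℕ) :
    ∃ P : ℂ, gaussHalf a (1 - a) c = P * gaussHalf a (1 - a) (c + 2 * k) ∧
      baileyValue a c = P * baileyValue a (c + 2 * k) := by
  induction k with
  | zero => exact ⟨1, by simp, by simp⟩
  | succ k ih =>
    obtain ⟨P, h1, h2⟩ := ih
    rw [gaussHalf_one_sub_eq_mul_add_two a (c + 2 * k)] at h1
    rw [baileyValue_eq_mul_add_two a (c + 2 * k)] at h2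
    refine ⟨P * ((c + 2 * k + a) * (c + 2 * k + 1 - a)), ?_, ?_⟩
    · push_cast
      rw [h1, show c + 2 * k + 2 = c + 2 * (k + 1) by ring]; ring
    · push_cast
      rw [h2, show c + 2 * k + 2 = c + 2 * (k + 1) by ring]; ring

/-- **Bailey's summation theorem** in regularized form. -/
theorem gaussHalf_one_sub (a c : ℂ) : gaussHalf a (1 - a) c = baileyValue a c := by
  have large : ∀ s : ℂ, 0 < s.re → 0 < (s + a / 2).re → 0 < (s + (1 - a) / 2).re →
      gaussHalf a (1 - a) (2 * s) = baileyValue a (2 * s) := by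
    intro s h0 h1 h2
    have hB := tendsto_Gamma_mul_baileyValue h0 h1 h2
    have hF := (tendsto_add_atTop_iff_nat 1).2
      (tendsto_Gamma_mul_gaussHalf a (1 - a) (c := 2 * s) (by simpa using h0))
    -- Cross-multiplied, the two sequences coincide; their limits are the two sides.
    have h := tendsto_nhds_unique ((hB.const_mul (gaussHalf a (1 - a) (2 * s))).congr fun k => ?_)
      (hF.const_mul (baileyValue a (2 * s)))
    · simpa using h
    · obtain ⟨P, e1, e2⟩ := exists_common_factor a (2 * s) (k + 1)
      rw [e1, e2]; ring
  obtain ⟨k, hk⟩ := exists_nat_gt (|c.re| + |a.re| + 1)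
  obtain ⟨P, e1, e2⟩ := exists_common_factor a c k
  have hc := abs_le.1 (le_refl |c.re|)
  have ha := abs_le.1 (le_refl |a.re|)
  have e : c + 2 * k = 2 * (c / 2 + k) := by ring
  have hr : ∀ z : ℂ, (z / 2).re = z.re / 2 := fun z => by
    rw [show z / 2 = z / (2 : ℝ) by simp, Complex.div_ofReal_re]
  rw [e1, e2, e, large]
  · simp [hr]; linarith
  · simp [hr]; linarith
  · simp [hr]; linarith

/-! ### Bailey's theorem with the second parameter shifted by ±i. -/

/-- The binomial sum `∑ᵣ σʳ (i choose r) Γ((x + r) / 2) / Γ((y + r) / 2)`. -/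
noncomputable def gammaRatioSum (σ : ℂ) (i : ℕ) (x y : ℂ) : ℂ :=
  ∑ r ∈ range (i + 1), σ ^ r * (i.choose r : ℂ) *
    (Complex.Gamma ((x + r) / 2) / Complex.Gamma ((y + r) / 2))

lemma gammaRatioSum_zero (σ x y : ℂ) :
    gammaRatioSum σ 0 x y = Complex.Gamma (x / 2) / Complex.Gamma (y / 2) := by
  simp [gammaRatioSum]

lemma gammaRatioSum_succ (σ : ℂ) (i : ℕ) (x y : ℂ) :
    gammaRatioSum σ (i + 1) x y =
      gammaRatioSum σ i x y + σ * gammaRatioSum σ i (x + 1) (y + 1) := by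
  have h := Finset.sum_choose_succ_mul (R := ℂ) (fun r _ => σ ^ r *
    (Complex.Gamma ((x + r) / 2) / Complex.Gamma ((y + r) / 2))) i
  simp only [gammaRatioSum, mul_sum]
  convert h using 2
  · ring
  · exact sum_congr rfl fun r _ => by ring
  · refine sum_congr rfl fun r _ => ?_
    push_cast
    rw [show x + 1 + r = x + (r + 1) by ring, show y + 1 + r = y + (r + 1) by ring]
    ring

lemma ne_neg_natCast_of_half {x : ℂ} (h0 : ∀ k : ℕ, x / 2 ≠ -(k : ℂ))
    (h1 : ∀ k : ℕ, (x + 1) / 2 ≠ -(k : ℂ)) (k : ℕ) : x ≠ -(k : ℂ) := by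
  rintro rfl
  obtain ⟨j, rfl | rfl⟩ := k.even_or_odd'
  · exact h0 j (by push_cast; ring)
  · exact h1 j (by push_cast; ring)

lemma baileyValue_eq {a c : ℂ} (h : ∀ k : ℕ, (c - a) / 2 ≠ -(k : ℂ)) :
    baileyValue a c = (2 : ℂ) ^ (-a) / Complex.Gamma (c - a) *
      (Complex.Gamma ((c - a) / 2) / Complex.Gamma ((c + a) / 2)) := by
  have hΓ := Complex.Gamma_ne_zero h
  have hd := Complex.Gamma_mul_Gamma_add_half ((c - a) / 2)
  have hpow : (2 : ℂ) ^ (1 - (c - a)) ≠ 0 := by simp [Complex.cpow_eq_zero_iff]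
  have hpi : ((√Real.pi : ℝ) : ℂ) ≠ 0 := by
    exact_mod_cast (Real.sqrt_pos.2 Real.pi_pos).ne'
  rw [show 2 * ((c - a) / 2) = c - a by ring,
    show (c - a) / 2 + 1 / 2 = (c + 1 - a) / 2 by ring] at hd
  rw [baileyValue, show 1 - c = -a + (1 - (c - a)) by ring, Complex.cpow_add _ _ two_ne_zero]
  -- If c - a is a pole, both sides are 0 through the convention for inverses.
  by_cases h0 : Complex.Gamma (c - a) = 0
  · have : Complex.Gamma ((c + 1 - a) / 2) = 0 := by
      rw [h0, zero_mul, zero_mul] at hd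
      exact (mul_eq_zero.1 hd).resolve_left hΓ
    simp [h0, this]
  · have h2 : Complex.Gamma ((c + 1 - a) / 2) ≠ 0 := by
      intro h2
      rw [h2, mul_zero] at hd
      exact mul_ne_zero (mul_ne_zero h0 hpow) hpi hd.symm
    rw [div_eq_mul_inv _ (Complex.Gamma ((c + a) / 2))]
    field_simp
    linear_combination -(Complex.Gamma ((c + a) / 2))⁻¹ * hd

/-- Generalized Bailey summation with the second parameter shifted downwards. -/
theorem gaussHalf_one_sub_sub (i : ℕ) : ∀ {a c : ℂ},
    (∀ r ∈ range (i + 1), ∀ k : ℕ, (c - a + r) / 2 ≠ -(k : ℂ)) →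
    gaussHalf a (1 - a - i) c =
      (2 : ℂ) ^ (-a - (i : ℂ)) / Complex.Gamma (c - a) * gammaRatioSum 1 i (c - a) (c + a) := by
  induction i with
  | zero =>
    intro a c h
    have h0 : ∀ k : ℕ, (c - a) / 2 ≠ -(k : ℂ) := by simpa using h 0 (by simp)
    simp [gammaRatioSum_zero, gaussHalf_one_sub, baileyValue_eq h0]
  | succ i ih =>
    intro a c h
    have hx : ∀ k : ℕ, c - a ≠ -(k : ℂ) := ne_neg_natCast_of_half
      (by simpa using h 0 (by simp)) (by simpa using h 1 (by simp))
    have hx0 : c - a ≠ 0 := by simpa using hx 0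
    have hΓ := Complex.Gamma_ne_zero hx
    have e1 := ih (a := a) (c := c) fun r hr => h r (by simp at hr ⊢; omega)
    have e2 := ih (a := a) (c := c + 1) fun r hr k => by
      have := h (r + 1) (by simp at hr ⊢; omega) k
      rw [show c + 1 - a + r = c - a + (r + 1 : ℕ) by push_cast; ring]
      exact this
    -- The factor c - a of the contiguous relation cancels against Γ(c - a + 1) = (c - a) Γ(c - a).
    rw [show 1 - a - (i + 1 : ℕ) = 1 - a - i - 1 by push_cast; ring, gaussHalf_sub_one, e1, e2,
      gammaRatioSum_succ, show c + 1 - a = c - a + 1 by ring, show c + 1 + a = c + a + 1 by ring,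
      Complex.Gamma_add_one _ hx0, show -a - ((i + 1 : ℕ) : ℂ) = -a - i - 1 by push_cast; ring,
      Complex.cpow_sub (-a - i) _ two_ne_zero, Complex.cpow_one]
    field_simp

/-- Generalized Bailey summation with the second parameter shifted upwards. -/
theorem gaussHalf_one_sub_add (i : ℕ) : ∀ {a c : ℂ}, (∀ k : ℕ, a - i ≠ -(k : ℂ)) →
    (∀ r ∈ range (i + 1), ∀ k : ℕ, (c - a + r) / 2 ≠ -(k : ℂ)) →
    gaussHalf a (1 - a + i) c =
      (2 : ℂ) ^ ((i : ℂ) - a) * Complex.Gamma (a - i) / (Complex.Gamma (c - a) * Complex.Gamma a) *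
        gammaRatioSum (-1) i (c - a) (c + a - 2 * i) := by
  induction i with
  | zero =>
    intro a c ha h
    have h0 : ∀ k : ℕ, (c - a) / 2 ≠ -(k : ℂ) := by simpa using h 0 (by simp)
    have hΓ : Complex.Gamma a ≠ 0 := Complex.Gamma_ne_zero (by simpa using ha)
    have : (2 : ℂ) ^ (-a) * Complex.Gamma a / (Complex.Gamma (c - a) * Complex.Gamma a) =
        (2 : ℂ) ^ (-a) / Complex.Gamma (c - a) := mul_div_mul_right _ _ hΓ
    simp [gammaRatioSum_zero, gaussHalf_one_sub, baileyValue_eq h0, this]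
  | succ i ih =>
    intro a c ha h
    have hx : ∀ k : ℕ, c - a ≠ -(k : ℂ) := ne_neg_natCast_of_half
      (by simpa using h 0 (by simp)) (by simpa using h 1 (by simp))
    have hx0 : c - a ≠ 0 := by simpa using hx 0
    have hΓ := Complex.Gamma_ne_zero hx
    have ha1 : ∀ k : ℕ, a - 1 ≠ -(k : ℂ) := fun k hk => ha (k + i) <| by
      push_cast; linear_combination hk
    have ha0 : a - 1 ≠ 0 := by simpa using ha1 0
    have hΓa := Complex.Gamma_ne_zero ha1
    have hai : ∀ k : ℕ, a - 1 - i ≠ -(k : ℂ) := fun k hk => ha k <| by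
      push_cast; linear_combination hk
    -- As 1 - a + (i + 1) = 1 - (a - 1) + i, lowering a absorbs one upward shift.
    have e1 := ih (a := a - 1) (c := c - 1) hai fun r hr k => by
      rw [show c - 1 - (a - 1) + r = c - a + r by ring]
      exact h r (by simp at hr ⊢; omega) k
    have e2 := ih (a := a - 1) (c := c) hai fun r hr k => by
      rw [show c - (a - 1) + r = c - a + (r + 1 : ℕ) by push_cast; ring]
      exact h (r + 1) (by simp at hr ⊢; omega) k
    have hrec := Complex.Gamma_add_one _ ha0
    rw [sub_add_cancel] at hrec
    rw [show c - 1 - (a - 1) = c - a by ring, show c - 1 + (a - 1) - 2 * i =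
      c + a - 2 * (i + 1 : ℕ) by push_cast; ring] at e1
    rw [show c - (a - 1) = c - a + 1 by ring, show c + (a - 1) - 2 * i =
      c + a - 2 * (i + 1 : ℕ) + 1 by push_cast; ring, Complex.Gamma_add_one _ hx0] at e2
    rw [← mul_right_inj' ha0, sub_one_mul_gaussHalf,
      show 1 - a + (i + 1 : ℕ) = 1 - (a - 1) + i by push_cast; ring, e1, e2,
      gammaRatioSum_succ, hrec, show a - ((i + 1 : ℕ) : ℂ) = a - 1 - i by push_cast; ring,
      show ((i + 1 : ℕ) : ℂ) - a = i - (a - 1) by push_cast; ring]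
    field_simp
    ring

/-! ### The double series: convergence and reduction to a Gauss series. -/

lemma kampeDeFerietTerm_eq (α β ε b₁ b₂ δ : ℂ) (m n : ℕ) :
    kampeDeFerietTerm [α] [ε] [b₁, b₂] [β] [] [δ] (1 / 2) (1 / 2) m n =
      rising α (m + n) / rising β (m + n) * (1 / 2) ^ (m + n) *
        (rising ε m * rising b₁ n * rising b₂ n / (rising δ n * (m.factorial * n.factorial))) := by
  simp only [kampeDeFerietTerm, pochhammerProd, rising, List.map_cons, List.map_nil,
    List.prod_cons, List.prod_nil, mul_one]
  rw [pow_add]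
  simp only [div_eq_mul_inv, mul_inv]
  ring

lemma exists_norm_rising_div_le (a b : ℂ) :
    ∃ C : ℝ, ∀ n, ‖rising a n / rising b n * (2 / 3) ^ n‖ ≤ C := by
  have hs : Summable fun n => rising a n / rising b n * (2 / 3 : ℂ) ^ n := by
    refine summable_mul_pow_of_ratio_tendsto_one (Eventually.of_forall fun n => ?_)
      (tendsto_add_natCast_div a b) (by norm_num)
    rw [rising_succ, rising_succ, mul_div_mul_comm, mul_comm]
  obtain ⟨C, hC⟩ := hs.tendsto_atTop_zero.norm.bddAbove_range
  exact ⟨C, fun n => hC ⟨n, rfl⟩⟩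

/-- Split 1/2 = (2/3)(3/4): the powers of 2/3 keep the factor coupling m and n bounded, and those of
3/4 leave a product of two convergent series. -/
lemma summable_kampeDeFerietTerm (α β ε b₁ b₂ : ℂ) {δ : ℂ}
    (hδ : ∀ k : ℕ, δ ≠ -(k : ℂ)) :
    Summable fun p : ℕ × ℕ =>
      kampeDeFerietTerm [α] [ε] [b₁, b₂] [β] [] [δ] (1 / 2) (1 / 2) p.1 p.2 := by
  have h1 : ∀ n : ℕ, (1 + n : ℂ) ≠ 0 := fun n => by
    rw [add_comm]; exact_mod_cast n.succ_ne_zero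
  have hA : Summable fun m => rising ε m / m.factorial * (3 / 4 : ℂ) ^ m := by
    refine summable_mul_pow_of_ratio_tendsto_one (Eventually.of_forall fun n => ?_)
      (tendsto_add_natCast_div ε 1) (by norm_num)
    have := h1 n
    have h2 : (n.factorial : ℂ) ≠ 0 := by exact_mod_cast n.factorial_ne_zero
    rw [rising_succ, Nat.factorial_succ]
    push_cast
    rw [add_comm (n : ℂ) 1]
    field_simp
  have hB : Summable fun n =>
      rising b₁ n * rising b₂ n / (rising δ n * n.factorial) * (3 / 4 : ℂ) ^ n := by
    refine summable_mul_pow_of_ratio_tendsto_one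
      (q := fun n => (b₁ + n) / (δ + n) * ((b₂ + n) / (1 + n)))
      (Eventually.of_forall fun n => ?_) ?_ (by norm_num)
    · have := h1 n
      have h2 : (n.factorial : ℂ) ≠ 0 := by exact_mod_cast n.factorial_ne_zero
      have h3 := rising_ne_zero hδ n
      have h4 := rising_ne_zero hδ (n + 1)
      rw [rising_succ] at h4
      have h5 := right_ne_zero_of_mul h4
      simp only [rising_succ]
      rw [Nat.factorial_succ]
      push_cast
      rw [add_comm (n : ℂ) 1]
      field_simp
    · simpa using (tendsto_add_natCast_div b₁ δ).mul (tendsto_add_natCast_div b₂ 1)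
  obtain ⟨C, hC⟩ := exists_norm_rising_div_le α β
  refine Summable.of_norm_bounded
    ((hA.norm.mul_of_nonneg hB.norm (fun _ => norm_nonneg _) fun _ => norm_nonneg _).mul_left C)
    fun p => ?_
  obtain ⟨m, n⟩ := p
  have e : kampeDeFerietTerm [α] [ε] [b₁, b₂] [β] [] [δ] (1 / 2) (1 / 2) m n =
      rising α (m + n) / rising β (m + n) * (2 / 3) ^ (m + n) *
        (rising ε m / m.factorial * (3 / 4 : ℂ) ^ m *
          (rising b₁ n * rising b₂ n / (rising δ n * n.factorial) * (3 / 4 : ℂ) ^ n)) := by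
    rw [kampeDeFerietTerm_eq, show (1 / 2 : ℂ) = 2 / 3 * (3 / 4) by norm_num, mul_pow,
      pow_add (3 / 4 : ℂ)]
    simp only [div_eq_mul_inv, mul_inv]
    ring
  rw [e, norm_mul, norm_mul (rising ε m / m.factorial * (3 / 4 : ℂ) ^ m)]
  exact mul_le_mul_of_nonneg_right (hC _) (by positivity)

lemma kampeDeFeriet_eq_tsum_antidiagonal (α β ε b₁ b₂ : ℂ) {δ : ℂ}
    (hδ : ∀ k : ℕ, δ ≠ -(k : ℂ)) :
    kampeDeFeriet [α] [ε] [b₁, b₂] [β] [] [δ] (1 / 2) (1 / 2) =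
      ∑' N, ∑ p ∈ antidiagonal N,
        kampeDeFerietTerm [α] [ε] [b₁, b₂] [β] [] [δ] (1 / 2) (1 / 2) p.1 p.2 := by
  have h := summable_kampeDeFerietTerm α β ε b₁ b₂ hδ
  rw [kampeDeFeriet, ← h.tsum_prod, ← HasAntidiagonal.sigmaAntidiagonalEquivProd.tsum_eq,
    Summable.tsum_sigma' (fun n => (hasSum_fintype _).summable) (by
      exact HasAntidiagonal.sigmaAntidiagonalEquivProd.summable_iff.2 h)]
  refine tsum_congr fun N => ?_
  rw [tsum_fintype]
  exact Finset.sum_finset_coe (fun p : ℕ × ℕ =>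
    kampeDeFerietTerm [α] [ε] [b₁, b₂] [β] [] [δ] (1 / 2) (1 / 2) p.1 p.2) _

/-- Reduction of the double series to a Gauss series at `1/2`. -/
theorem kampeDeFeriet_eq_gaussHalf (α ε b : ℂ) {β δ : ℂ} (hβ : ∀ k : ℕ, β ≠ -(k : ℂ))
    (hδ : ∀ k : ℕ, δ ≠ -(k : ℂ)) (h : δ = b + β) :
    kampeDeFeriet [α] [ε] [β - ε, b] [β] [] [δ] (1 / 2) (1 / 2) =
      Complex.Gamma δ * gaussHalf α (b + ε) δ := by
  rw [kampeDeFeriet_eq_tsum_antidiagonal α β ε _ b hδ, gaussHalf, ← tsum_mul_left]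
  refine tsum_congr fun N => ?_
  have hd : b + ε + (β - ε) = δ := by rw [h]; ring
  have hS := sum_antidiagonal_saalschutz ε (β - ε) b (by rwa [hd]) N
  rw [hd, add_sub_cancel] at hS
  rw [Gamma_mul_gaussHalfTerm hδ]
  have hβN := rising_ne_zero hβ N
  calc _ = ∑ p ∈ antidiagonal N, rising α N / rising β N * (1 / 2) ^ N *
        (rising ε p.1 * rising (β - ε) p.2 * rising b p.2 /
          (rising δ p.2 * (p.1.factorial * p.2.factorial))) := by
        refine sum_congr rfl fun p hp => ?_
        rw [kampeDeFerietTerm_eq, HasAntidiagonal.mem_antidiagonal.1 hp]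
    _ = _ := by
        rw [← mul_sum, hS]
        field_simp

end KampeDeFerietAux

theorem theorem1 (i : ℕ) (α β ε : ℂ)
    (hβ : ∀ k : ℕ, β ≠ -(k : ℂ)) :
    ((∀ k : ℕ, 1 - α - ε + β + i ≠ -(k : ℂ)) →
      (∀ k : ℕ, α - i ≠ -(k : ℂ)) →
      (∀ r ∈ Finset.range (i + 1), ∀ k : ℕ,
        (1 - 2 * α - ε + β + i + r) / 2 ≠ -(k : ℂ)) →
      (Summable fun p : ℕ × ℕ =>
          kampeDeFerietTerm [α] [ε] [β - ε, 1 - α - ε + i] [β] [] [1 - α - ε + β + i]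
            (1 / 2) (1 / 2) p.1 p.2) ∧
        kampeDeFeriet [α] [ε] [β - ε, 1 - α - ε + i] [β] [] [1 - α - ε + β + i]
            (1 / 2) (1 / 2) =
          (2 : ℂ) ^ ((i : ℂ) - α) * Complex.Gamma (β - ε - α + i + 1) * Complex.Gamma (α - i) /
              (Complex.Gamma (1 - 2 * α - ε + β + i) * Complex.Gamma α) *
            ∑ r ∈ Finset.range (i + 1), (-1 : ℂ) ^ r * (i.choose r : ℂ) *
              (Complex.Gamma ((1 - 2 * α - ε + β + i + r) / 2) /
                Complex.Gamma ((β - ε - i + r + 1) / 2))) ∧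
    ((∀ k : ℕ, 1 - α - ε + β - i ≠ -(k : ℂ)) →
      (∀ r ∈ Finset.range (i + 1), ∀ k : ℕ,
        (1 - 2 * α - ε + β - i + r) / 2 ≠ -(k : ℂ)) →
      (Summable fun p : ℕ × ℕ =>
          kampeDeFerietTerm [α] [ε] [β - ε, 1 - α - ε - i] [β] [] [1 - α - ε + β - i]
            (1 / 2) (1 / 2) p.1 p.2) ∧
        kampeDeFeriet [α] [ε] [β - ε, 1 - α - ε - i] [β] [] [1 - α - ε + β - i]
            (1 / 2) (1 / 2) =
          (2 : ℂ) ^ (-α - (i : ℂ)) * Complex.Gamma (β - ε - α - i + 1) /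
              Complex.Gamma (1 - 2 * α - ε + β - i) *
            ∑ r ∈ Finset.range (i + 1), (i.choose r : ℂ) *
              (Complex.Gamma ((1 - 2 * α - ε + β - i + r) / 2) /
                Complex.Gamma ((β - ε - i + r + 1) / 2))) := by
  refine ⟨fun hδ hα hr => ⟨summable_kampeDeFerietTerm _ _ _ _ _ hδ, ?_⟩,
    fun hδ hr => ⟨summable_kampeDeFerietTerm _ _ _ _ _ hδ, ?_⟩⟩
  · rw [kampeDeFeriet_eq_gaussHalf α ε _ hβ hδ (by ring),
      show 1 - α - ε + (i : ℂ) + ε = 1 - α + i by ring, gaussHalf_one_sub_add i hα fun r hr' k => by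
        rw [show 1 - α - ε + β + i - α + r = 1 - 2 * α - ε + β + i + r by ring]
        exact hr r hr' k,
      show 1 - α - ε + β + i - α = 1 - 2 * α - ε + β + i by ring,
      show 1 - α - ε + β + i + α - 2 * i = β - ε - i + 1 by ring,
      show 1 - α - ε + β + i = β - ε - α + i + 1 by ring, gammaRatioSum]
    simp only [add_right_comm _ (1 : ℂ)]
    ring
  · rw [kampeDeFeriet_eq_gaussHalf α ε _ hβ hδ (by ring),
      show 1 - α - ε - (i : ℂ) + ε = 1 - α - i by ring, gaussHalf_one_sub_sub i fun r hr' k => by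
        rw [show 1 - α - ε + β - i - α + r = 1 - 2 * α - ε + β - i + r by ring]
        exact hr r hr' k,
      show 1 - α - ε + β - i - α = 1 - 2 * α - ε + β - i by ring,
      show 1 - α - ε + β - i + α = β - ε - i + 1 by ring,
      show 1 - α - ε + β - i = β - ε - α - i + 1 by ring, gammaRatioSum]
    simp only [add_right_comm _ (1 : ℂ), one_pow, one_mul]
    ring
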